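/- Let $(S,\mathfrak n,k)$ be a regular local ring of dimension $2$ and let $I\subseteq\mathfrak n^2$ be an ideal. Put $R=S/I$ and $\mathfrak m=\mathfrak nR$, and assume that the $R$-module $\mathfrak m$ is indecomposable (nonzero, and not a direct sum of two nonzero submodules). Let $\mathrm{syz}_1^R(\mathfrak m)$ be the first syzygy module of $\mathfrak m$, that is, the kernel of a minimal free cover $F\to\mathfrak m$ ($F$ free of finite rank, $F\to\mathfrak m$ surjective with kernel contained in $\mathfrak mF$), and let $\mu(\cdot)$ denote the minimal number of generators. Then there is a decomposition $\mathrm{syz}_1^R(\mathfrak m)=N\oplus N'$ with $N'\cong k^a$ for some integer $a\ge 0$ and such that $N$ has no direct summand isomorphic to $k$. For every such decomposition: (a) $a=\dim_k\left(\dfrac{\mathfrak n(I:\mathfrak n)}{\mathfrak nI}\right)$ and $\mu(N)=\mu(I)+1-a\ge 1$; (b) $N$ is indecomposable. -/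

import Mathlib

open IsLocalRing

/-- A module is indecomposable if it is nonzero and is not the internal direct sum of two nonzero
submodules. -/
def IsIndecomposableModule (R M : Type*) [CommRing R] [AddCommGroup M] [Module R M] : Prop :=
  Nontrivial M ∧ ∀ A B : Submodule R M, IsCompl A B → A = ⊥ ∨ B = ⊥

/-- `M` has a direct summand isomorphic to `K`. -/
def HasSummandIso (R M K : Type*) [CommRing R] [AddCommGroup M] [Module R M]
    [AddCommGroup K] [Module R K] : Prop :=
  ∃ A B : Submodule R M, IsCompl A B ∧ Nonempty (A ≃ₗ[R] K)

/-- `π : F → M` is a minimal free cover over the local ring `R` with maximal ideal `m`: `F` is free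
of finite rank, `π` is onto and `ker π ⊆ m F`. Its kernel is then the first syzygy module of `M` in
a minimal free resolution, `syz₁(M)`. -/
structure IsMinimalFreeCover {R F M : Type*} [CommRing R] (m : Ideal R)
    [AddCommGroup F] [Module R F] [AddCommGroup M] [Module R M] (π : F →ₗ[R] M) : Prop where
  free : Module.Free R F
  finite : Module.Finite R F
  surjective : Function.Surjective π
  ker_le : LinearMap.ker π ≤ m • (⊤ : Submodule R F)

/-- `Z = N ⊕ N'` with `N' ≅ (R ⧸ m) ^ a`, and `N` has no direct summand isomorphic to `R ⧸ m`. -/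
structure IsResidueSplitting {R Z : Type*} [CommRing R] (m : Ideal R) [AddCommGroup Z] [Module R Z]
    (N N' : Submodule R Z) (a : ℕ) : Prop where
  isCompl : IsCompl N N'
  iso : Nonempty (N' ≃ₗ[R] (Fin a → R ⧸ m))
  no_summand : ¬ HasSummandIso R N (R ⧸ m)

section ColonQuotient

variable {S : Type*} [CommRing S] [IsLocalRing S] (I : Ideal S)

/-- The ideal `𝔫 (I : 𝔫)`, where `𝔫` is the maximal ideal of `S`. -/
def maximalMulColon : Ideal S :=
  maximalIdeal S * Submodule.colon I (maximalIdeal S : Set S)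

/-- The `S`-module `𝔫 (I : 𝔫) / 𝔫 I`. (As `𝔫 I ⊆ 𝔫 (I : 𝔫)`, nothing is lost by viewing `𝔫 I` inside
`𝔫 (I : 𝔫)`.) -/
abbrev ColonQuotient : Type _ :=
  maximalMulColon I ⧸ (maximalIdeal S * I).submoduleOf (maximalMulColon I)

theorem maximalMulColon_le : maximalMulColon I ≤ I := by
  refine Ideal.mul_le.2 fun r hr s hs => ?_
  rw [mul_comm]
  exact Submodule.mem_colon.1 hs r hr

theorem colonQuotient_isTorsion :
    Module.IsTorsionBySet S (ColonQuotient I) (maximalIdeal S : Set S) := by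
  rintro q ⟨r, hr⟩
  obtain ⟨x, rfl⟩ := Submodule.Quotient.mk_surjective _ q
  refine (Submodule.Quotient.mk_eq_zero _).2 ?_
  exact Ideal.mul_mem_mul hr (maximalMulColon_le I x.2)

/-- `𝔫 (I : 𝔫) / 𝔫 I` as a vector space over the residue field of `S`: the scalar multiplication is
induced by that of `S`. -/
noncomputable instance ColonQuotient.instModuleResidueField :
    Module (ResidueField S) (ColonQuotient I) :=
  (colonQuotient_isTorsion I).module

end ColonQuotient

/-! ### Splitting off copies of the residue field -/

section ResidueSummands

variable {R : Type*} [CommRing R]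

/-! Let `𝔫 = (X, Y)`, let `x, y` be the images in `R`, `Z = syz₁(𝔪) ⊆ R²` and `κ = y e₁ - x e₂`. For
`ζ = a e₁ + b e₂` in `Z` the relation `ax + by = 0` gives `xζ = -bκ` and `yζ = aκ`. Since `I ⊆ 𝔫²`,
the ideal `𝔪` is not principal, which forces `a, b ∈ 𝔪`. Hence `𝔪Z = 𝔪κ` (`exists_smul_cycle_eq`,
`mem_smul_top_ker_iff`), and `κ` controls everything.

Numbers: `κ ∉ 𝔪Z`, and `ζ ↦ aX + bY`, computed on lifts to `S`, identifies `Z/Rκ` with `I/𝔫I` by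
exactness of the Koszul complex (`exists_eq_mul_of_add_eq_zero`). So `μ(Z) = μ(I) + 1`. The socle of
`Z` has its coefficients in `(I : 𝔫)/I` and projects onto `N'` with kernel `soc Z ∩ N = soc Z ∩ Rκ`,
whence `N' ≅ 𝔫(I : 𝔫)/𝔫I`.

Indecomposability: let `N = A ⊕ B` with projections `P, Q` of `Z`, and let `p, q ⊆ 𝔪` be the
annihilators in `𝔪` of `Pκ, Qκ`. Comparing `rPκ ∈ 𝔪κ` with its images under `P` and `Q` gives `p + q
= 𝔪`. If `p` or `q` is all of `𝔪`, then `A` or `B` is killed by `𝔪`, hence zero because `N` has no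
summand `k`. Otherwise `𝔪 = (x, y)` with `x ∈ p`, `y ∈ q`, and a computation in `R²` yields `Rx ∩ Ry
= 0`, so `𝔪` would decompose (`smul_projection_eq_zero_or`, `span_inf_span_eq_bot_of_projections`).
-/

theorem isTorsionBySet_quotient_smul_top (V : Type*) [AddCommGroup V] [Module R V] (J : Ideal R) :
    Module.IsTorsionBySet R (V ⧸ J • (⊤ : Submodule R V)) (J : Set R) := by
  rintro q ⟨r, hr⟩
  obtain ⟨v, rfl⟩ := Submodule.Quotient.mk_surjective _ q
  exact (Submodule.Quotient.mk_eq_zero _).2 (Submodule.smul_mem_smul hr trivial)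

variable {M : Type*} [AddCommGroup M] [Module R M]

/-- A linear map sends `J M` into `J M'`. -/
theorem map_mem_smul_top {M' : Type*} [AddCommGroup M'] [Module R M'] (P : M →ₗ[R] M') (J : Ideal R)
    {z : M} (hz : z ∈ J • (⊤ : Submodule R M)) : P z ∈ J • (⊤ : Submodule R M') := by
  have := Submodule.mem_map_of_mem (f := P) hz
  rw [Submodule.map_smul''] at this
  exact Submodule.smul_mono le_rfl le_top this

theorem mem_smul_top_of_isCompl {A B : Submodule R M} (h : IsCompl A B) (J : Ideal R) (s : A)
    (hs : (s : M) ∈ J • (⊤ : Submodule R M)) : s ∈ J • (⊤ : Submodule R A) := by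
  have := map_mem_smul_top (A.projectionOnto B h) J hs
  rwa [Submodule.projectionOnto_apply_left] at this

/-- For a direct summand, `A ∩ JM = JA`, and here `JA = 0`. -/
theorem eq_zero_of_isCompl_of_smul_eq_zero {A B : Submodule R M} (h : IsCompl A B) {J : Ideal R}
    (hA : ∀ r ∈ J, ∀ a ∈ A, r • a = 0) {s : M} (hs : s ∈ A) (hsJ : s ∈ J • (⊤ : Submodule R M)) :
    s = 0 := by
  have h1 := mem_smul_top_of_isCompl h J ⟨s, hs⟩ hsJ
  have h2 : J • (⊤ : Submodule R A) = ⊥ := by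
    rw [eq_bot_iff, Submodule.smul_le]
    intro r hr a _
    exact Subtype.ext (hA r hr a a.2)
  rw [h2, Submodule.mem_bot] at h1
  exact congrArg Subtype.val h1

variable [IsLocalRing R]

theorem isSemisimpleModule_of_isTorsionBySet_maximalIdeal {V : Type*} [AddCommGroup V] [Module R V]
    (h : Module.IsTorsionBySet R V (maximalIdeal R : Set R)) : IsSemisimpleModule R V := by
  let := h.module
  let := Ideal.Quotient.field (maximalIdeal R)
  exact h.isSemisimpleModule_iff.1 inferInstance

theorem nonempty_span_singleton_equiv_residue {s : M} (hs : ∀ r ∈ maximalIdeal R, r • s = 0)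
    (h0 : s ≠ 0) : Nonempty (Submodule.span R {s} ≃ₗ[R] (R ⧸ maximalIdeal R)) := by
  have hk : LinearMap.ker (LinearMap.toSpanSingleton R M s) = maximalIdeal R := by
    ext r
    rw [LinearMap.mem_ker, LinearMap.toSpanSingleton_apply]
    refine ⟨fun h => ?_, hs r⟩
    by_contra hr
    rw [mem_maximalIdeal, mem_nonunits_iff, not_not] at hr
    exact h0 (hr.smul_eq_zero.1 h)
  refine ⟨LinearEquiv.symm ((Submodule.quotEquivOfEq _ _ hk.symm).trans
    ((LinearMap.quotKerEquivRange _).trans (LinearEquiv.ofEq _ _ ?_)))⟩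
  exact LinearMap.range_toSpanSingleton s

/-- A socle element outside `𝔪 M` spans a direct summand. -/
theorem hasSummandIso_of_socle {s : M} (hs : ∀ r ∈ maximalIdeal R, r • s = 0)
    (hs' : s ∉ maximalIdeal R • (⊤ : Submodule R M)) :
    HasSummandIso R M (R ⧸ maximalIdeal R) := by
  have := isSemisimpleModule_of_isTorsionBySet_maximalIdeal
    (isTorsionBySet_quotient_smul_top M (maximalIdeal R))
  set q := (maximalIdeal R • (⊤ : Submodule R M)).mkQ with hq
  have hqs : ∀ z, q z = 0 ↔ z ∈ maximalIdeal R • (⊤ : Submodule R M) := fun z =>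
    Submodule.Quotient.mk_eq_zero _
  obtain ⟨U, hU⟩ := exists_isCompl (Submodule.span R {q s})
  refine ⟨Submodule.span R {s}, U.comap q, ⟨?_, ?_⟩,
    nonempty_span_singleton_equiv_residue hs fun h => hs' (h ▸ zero_mem _)⟩
  · rw [Submodule.disjoint_def]
    intro z hz hzU
    obtain ⟨r, rfl⟩ := Submodule.mem_span_singleton.1 hz
    have h0 : q (r • s) = 0 := by
      refine Submodule.disjoint_def.1 hU.disjoint _ ?_ hzU
      rw [map_smul]
      exact Submodule.smul_mem _ _ (Submodule.mem_span_singleton_self _)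
    by_cases hr : r ∈ maximalIdeal R
    · exact hs r hr
    · rw [mem_maximalIdeal, mem_nonunits_iff, not_not] at hr
      rw [map_smul, hr.smul_eq_zero, hqs] at h0
      exact absurd h0 hs'
  · rw [codisjoint_iff, eq_top_iff]
    intro z _
    obtain ⟨u, hu, v, hv, huv⟩ := Submodule.mem_sup.1 (hU.sup_eq_top ▸ Submodule.mem_top (x := q z))
    obtain ⟨r, rfl⟩ := Submodule.mem_span_singleton.1 hu
    refine Submodule.mem_sup.2 ⟨r • s, Submodule.smul_mem _ _ (Submodule.mem_span_singleton_self _),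
      z - r • s, ?_, by abel⟩
    rw [Submodule.mem_comap, map_sub, map_smul, ← huv]
    simpa using hv

theorem socle_mem_smul_top (hM : ¬ HasSummandIso R M (R ⧸ maximalIdeal R)) {s : M}
    (hs : ∀ r ∈ maximalIdeal R, r • s = 0) : s ∈ maximalIdeal R • (⊤ : Submodule R M) :=
  by_contra fun h => hM (hasSummandIso_of_socle hs h)

theorem eq_bot_of_isCompl_of_smul_eq_zero (hM : ¬ HasSummandIso R M (R ⧸ maximalIdeal R))
    {A B : Submodule R M} (h : IsCompl A B) (hA : ∀ r ∈ maximalIdeal R, ∀ a ∈ A, r • a = 0) :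
    A = ⊥ :=
  eq_bot_iff.2 fun s hs => eq_zero_of_isCompl_of_smul_eq_zero h hA hs
    (socle_mem_smul_top hM fun r hr => hA r hr s hs)

/-- Splitting off a maximal direct sum of copies of the residue field. -/
theorem exists_isResidueSplitting [IsNoetherianRing R] [Module.Finite R M] :
    ∃ (a : ℕ) (N N' : Submodule R M), IsResidueSplitting (maximalIdeal R) N N' a := by
  set m := maximalIdeal R
  set mM := m • (⊤ : Submodule R M) with hmM
  have hssq := isSemisimpleModule_of_isTorsionBySet_maximalIdeal
    (isTorsionBySet_quotient_smul_top M m)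
  let soc : Submodule R M :=
    { carrier := {s | ∀ r ∈ m, r • s = 0}
      add_mem' := fun {a b} ha hb r hr => by rw [smul_add, ha r hr, hb r hr, add_zero]
      zero_mem' := fun r _ => smul_zero r
      smul_mem' := fun c s hs r hr => by rw [smul_comm, hs r hr, smul_zero] }
  have hsoc : Module.IsTorsionBySet R soc (m : Set R) := fun s r => Subtype.ext (s.2 r r.2)
  have hsss := isSemisimpleModule_of_isTorsionBySet_maximalIdeal hsoc
  -- `C` complements `soc ∩ 𝔪M` in the socle and will be `N'`; `N` is the preimage of a complement
  -- of the image of the socle in `M/𝔪M`.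
  obtain ⟨C₀, hC₀⟩ := exists_isCompl (mM.comap soc.subtype)
  set C := C₀.map soc.subtype with hC
  set q := mM.mkQ with hq
  have hq0 : ∀ z, q z = 0 ↔ z ∈ mM := fun z => Submodule.Quotient.mk_eq_zero _
  obtain ⟨U, hU⟩ := exists_isCompl (soc.map q)
  have hCsoc : ∀ c ∈ C, c ∈ soc := by
    rintro _ ⟨c, _, rfl⟩
    exact c.2
  have hCm : ∀ c ∈ C, c ∈ mM → c = 0 := by
    rintro _ ⟨c, hc, rfl⟩ h
    have := Submodule.disjoint_def.1 hC₀.disjoint c h hc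
    rw [this, map_zero]
  have hsplit : ∀ s ∈ soc, ∃ t ∈ mM, ∃ c ∈ C, t + c = s := by
    intro s hs
    obtain ⟨t, ht, c, hc, h⟩ := Submodule.mem_sup.1
      (hC₀.sup_eq_top ▸ Submodule.mem_top (x := (⟨s, hs⟩ : soc)))
    exact ⟨t, ht, c, Submodule.mem_map_of_mem hc, congrArg Subtype.val h⟩
  have hdisj : ∀ z ∈ U.comap q, z ∈ C → z = 0 := by
    intro z hzU hzC
    refine hCm z hzC ((hq0 z).1 ?_)
    exact Submodule.disjoint_def.1 hU.disjoint _ (Submodule.mem_map_of_mem (hCsoc z hzC)) hzU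
  have hcompl : IsCompl (U.comap q) C := by
    refine ⟨Submodule.disjoint_def.2 hdisj, ?_⟩
    rw [codisjoint_iff, eq_top_iff]
    intro z _
    obtain ⟨_, ⟨s, hs, rfl⟩, u, hu, huv⟩ :=
      Submodule.mem_sup.1 (hU.sup_eq_top ▸ Submodule.mem_top (x := q z))
    obtain ⟨t, ht, c, hc, rfl⟩ := hsplit s hs
    refine Submodule.mem_sup.2 ⟨z - c, ?_, c, hc, by abel⟩
    rw [Submodule.mem_comap, map_sub, ← huv, map_add, (hq0 t).2 ht]
    simpa using hu
  have htC : Module.IsTorsionBySet R C (m : Set R) :=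
    fun c r => Subtype.ext (hCsoc c c.2 r r.2)
  let := htC.module
  let := Ideal.Quotient.field m
  have : IsScalarTower R (R ⧸ m) C := htC.isScalarTower
  have : Module.Finite (R ⧸ m) C := Module.Finite.of_restrictScalars_finite R _ _
  have e := (Module.finBasis (R ⧸ m) C).equivFun
  refine ⟨_, U.comap q, C, hcompl, ⟨e.restrictScalars R⟩, ?_⟩
  rintro ⟨A, B, hAB, ⟨f⟩⟩
  have hA : ∀ r ∈ m, ∀ a ∈ A, r • a = 0 := by
    intro r hr a ha
    have h1 : r • (⟨a, ha⟩ : A) = 0 := by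
      apply f.injective
      rw [map_smul, map_zero]
      obtain ⟨t, ht⟩ := Ideal.Quotient.mk_surjective (f ⟨a, ha⟩)
      rw [← ht]
      exact Ideal.Quotient.eq_zero_iff_mem.2 (Ideal.mul_mem_right _ _ hr)
    exact congrArg Subtype.val h1
  -- Write a socle element `a` of `N` as `t + c`, with `t ∈ 𝔪M` and `c ∈ C`. Then `c = a - t` lies
  -- in `N ∩ C = 0`, so `a ∈ 𝔪M ∩ N = 𝔪N`, which misses a summand killed by `𝔪`.
  have hAbot : ∀ a ∈ A, a = 0 := by
    intro a ha
    have has : (a : M) ∈ soc := fun r hr => congrArg Subtype.val (hA r hr a ha)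
    obtain ⟨t, ht, c, hc, htc⟩ := hsplit a has
    have hc0 : c = 0 := by
      refine hdisj c ?_ hc
      have : c = a - t := by rw [← htc]; abel
      rw [this]
      refine sub_mem a.2 ?_
      rw [Submodule.mem_comap, (hq0 t).2 ht]
      exact zero_mem _
    rw [hc0, add_zero] at htc
    exact eq_zero_of_isCompl_of_smul_eq_zero hAB hA ha
      (mem_smul_top_of_isCompl hcompl m a (htc ▸ ht))
  obtain ⟨w, hw⟩ := f.surjective 1
  have hw0 : w = 0 := Subtype.ext (hAbot w w.2)
  rw [hw0, map_zero] at hw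
  exact zero_ne_one hw

end ResidueSummands

/-! ### Syzygies of a two-generated maximal ideal, and the splitting argument -/

section TwoGenerated

variable {R : Type*} [CommRing R] [IsLocalRing R]

/-- Exchange: if `J = (u, y)` and `u ∈ p + q`, then `u` can be replaced by an element of `p` or
of `q`. -/
theorem exists_span_pair_eq_of_mem_sup {J p q : Ideal R} (hp : p ≤ J) (hq : q ≤ J) {u y : R}
    (hJ : J = Ideal.span {u, y}) (hu : u ∈ p ⊔ q) : ∃ w, (w ∈ p ∨ w ∈ q) ∧ J = Ideal.span {w, y} := by
  obtain ⟨s, hs, t, ht, rfl⟩ := Submodule.mem_sup.1 hu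
  have hy : y ∈ J := hJ ▸ Ideal.subset_span (by simp)
  have key : ∀ w ∈ J, s + t ∈ Ideal.span {w, y} → J = Ideal.span {w, y} := by
    intro w hw h
    apply le_antisymm
    · rw [hJ, Ideal.span_le]
      rintro _ (rfl | rfl)
      · exact h
      · exact Ideal.subset_span (by simp)
    · rw [Ideal.span_le]
      rintro _ (rfl | rfl)
      · exact hw
      · exact hy
  obtain ⟨a, b, hab⟩ := Ideal.mem_span_pair.1 (hJ ▸ hp hs)
  obtain ⟨c, d, hcd⟩ := Ideal.mem_span_pair.1 (hJ ▸ hq ht)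
  by_cases ha : IsUnit a
  · refine ⟨s, Or.inl hs, key s (hp hs) ?_⟩
    obtain ⟨a', ha'⟩ := ha.exists_left_inv
    exact Ideal.mem_span_pair.2 ⟨a', -a' * b, by linear_combination (s + t) * ha' - a' * hab⟩
  · by_cases hc : IsUnit c
    · refine ⟨t, Or.inr ht, key t (hq ht) ?_⟩
      obtain ⟨c', hc'⟩ := hc.exists_left_inv
      exact Ideal.mem_span_pair.2 ⟨c', -c' * d, by linear_combination (s + t) * hc' - c' * hcd⟩
    -- With `u = s + t = (a + c)u + (b + d)y` and `1 - (a + c)` a unit, `y` alone generates `J`, so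
    -- any `w` would do.
    · refine ⟨s, Or.inl hs, key s (hp hs) ?_⟩
      have hac : IsUnit (1 - (a + c)) :=
        isUnit_one_sub_self_of_mem_nonunits _ ((maximalIdeal R).add_mem ha hc)
      obtain ⟨e, he⟩ := hac.exists_left_inv
      exact Ideal.mem_span_pair.2
        ⟨0, e * (b + d), by linear_combination (s + t) * he + e * (hab + hcd)⟩

theorem exists_span_pair_eq_of_sup_eq {J p q : Ideal R} {u v : R} (hJ : J = Ideal.span {u, v})
    (hpq : p ⊔ q = J) :
    p = J ∨ q = J ∨ ∃ x ∈ p, ∃ y ∈ q, J = Ideal.span {x, y} := by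
  have hp : p ≤ J := hpq ▸ le_sup_left
  have hq : q ≤ J := hpq ▸ le_sup_right
  obtain ⟨w, hw, h1⟩ := exists_span_pair_eq_of_mem_sup hp hq hJ
    (hpq ▸ hJ ▸ Ideal.subset_span (by simp))
  rw [Set.pair_comm] at h1
  obtain ⟨t, ht, h2⟩ := exists_span_pair_eq_of_mem_sup hp hq h1
    (hpq ▸ h1 ▸ Ideal.subset_span (by simp))
  have key : ∀ K : Ideal R, t ∈ K → w ∈ K → J ≤ K := by
    intro K h h'
    rw [h2, Ideal.span_le]
    rintro _ (rfl | rfl) <;> assumption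
  rcases ht with ht | ht <;> rcases hw with hw | hw
  · exact Or.inl (le_antisymm hp (key p ht hw))
  · exact Or.inr (Or.inr ⟨t, ht, w, hw, h2⟩)
  · exact Or.inr (Or.inr ⟨w, hw, t, ht, Set.pair_comm t w ▸ h2⟩)
  · exact Or.inr (Or.inl (le_antisymm hq (key q ht hw)))

/-- A unit coefficient would make one of the two generators redundant. -/
theorem coeff_mem_maximalIdeal_of_add_eq_zero (hnp : ∀ z, maximalIdeal R ≠ Ideal.span {z})
    {x y : R} (hgen : maximalIdeal R = Ideal.span {x, y}) {a b : R} (h : a * x + b * y = 0) :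
    a ∈ maximalIdeal R ∧ b ∈ maximalIdeal R := by
  have key : ∀ {x y : R}, maximalIdeal R = Ideal.span {x, y} → ∀ {a b : R}, a * x + b * y = 0 →
      a ∈ maximalIdeal R := by
    intro x y hgen a b h
    by_contra ha
    rw [mem_maximalIdeal, mem_nonunits_iff, not_not] at ha
    obtain ⟨a', ha'⟩ := ha.exists_left_inv
    refine hnp y (hgen.trans (le_antisymm ?_ (Ideal.span_mono (by simp))))
    rw [Ideal.span_le]
    rintro z (rfl | rfl)
    · exact Ideal.mem_span_singleton'.2 ⟨-a' * b, by linear_combination -a' * h + z * ha'⟩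
    · exact Ideal.mem_span_singleton_self _
  exact ⟨key hgen h, key (hgen.trans (by rw [Set.pair_comm])) ((add_comm _ _).trans h)⟩

theorem not_isIndecomposableModule_of_span_pair (hnp : ∀ z, maximalIdeal R ≠ Ideal.span {z})
    {x y : R} (hgen : maximalIdeal R = Ideal.span {x, y})
    (hd : ∀ z, z ∈ Ideal.span {x} → z ∈ Ideal.span {y} → z = 0) :
    ¬ IsIndecomposableModule R (maximalIdeal R) := by
  rintro ⟨-, h⟩
  have hx : x ∈ maximalIdeal R := hgen ▸ Ideal.subset_span (by simp)
  have hy : y ∈ maximalIdeal R := hgen ▸ Ideal.subset_span (by simp)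
  have hc : IsCompl (Submodule.span R {(⟨x, hx⟩ : maximalIdeal R)})
      (Submodule.span R {(⟨y, hy⟩ : maximalIdeal R)}) := by
    constructor
    · rw [Submodule.disjoint_def]
      intro z hz hz'
      obtain ⟨r, rfl⟩ := Submodule.mem_span_singleton.1 hz
      obtain ⟨s, hs⟩ := Submodule.mem_span_singleton.1 hz'
      have hs' : s * y = r * x := congrArg Subtype.val hs
      refine Subtype.ext (hd (r * x) (Ideal.mem_span_singleton'.2 ⟨r, rfl⟩)
        (Ideal.mem_span_singleton'.2 ⟨s, hs'⟩))
    · rw [codisjoint_iff, eq_top_iff]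
      rintro ⟨z, hz⟩ -
      obtain ⟨a, b, hab⟩ := Ideal.mem_span_pair.1 (hgen ▸ hz)
      exact Submodule.mem_sup.2 ⟨_, Submodule.smul_mem _ a (Submodule.mem_span_singleton_self _),
        _, Submodule.smul_mem _ b (Submodule.mem_span_singleton_self _), Subtype.ext hab⟩
  rcases h _ _ hc with h | h
  · have hx0 : x = 0 := congrArg Subtype.val (Submodule.span_singleton_eq_bot.1 h)
    refine hnp y (hgen.trans ?_)
    rw [hx0]
    exact Ideal.span_insert_zero
  · have hy0 : y = 0 := congrArg Subtype.val (Submodule.span_singleton_eq_bot.1 h)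
    refine hnp x (hgen.trans ?_)
    rw [hy0, Set.pair_comm]
    exact Ideal.span_insert_zero

variable {F : Type*} [AddCommGroup F] [Module R F]

/-- `e₁, e₂` is a basis of `F`. -/
structure IsBasisPair (R : Type*) {F : Type*} [CommRing R] [AddCommGroup F] [Module R F]
    (e₁ e₂ : F) : Prop where
  span : ∀ f : F, ∃ a b : R, f = a • e₁ + b • e₂
  indep : ∀ a b : R, a • e₁ + b • e₂ = 0 → a = 0 ∧ b = 0

omit [IsLocalRing R] in
theorem IsBasisPair.coeff_eq {e₁ e₂ : F} (h : IsBasisPair R e₁ e₂) {a b a' b' : R}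
    (hab : a • e₁ + b • e₂ = a' • e₁ + b' • e₂) : a = a' ∧ b = b' := by
  have := h.indep (a - a') (b - b') (by
    rw [sub_smul, sub_smul, sub_add_sub_comm, hab, sub_self])
  exact ⟨sub_eq_zero.1 this.1, sub_eq_zero.1 this.2⟩

variable {π : F →ₗ[R] maximalIdeal R}

/-- Nakayama makes `e₁, e₂` generate `F`, since `ker π ⊆ 𝔪F`. -/
theorem IsMinimalFreeCover.isBasisPair (hπ : IsMinimalFreeCover (maximalIdeal R) π)
    (hnp : ∀ z, maximalIdeal R ≠ Ideal.span {z}) {e₁ e₂ : F}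
    (hgen : maximalIdeal R = Ideal.span {(π e₁ : R), (π e₂ : R)}) : IsBasisPair R e₁ e₂ := by
  have := hπ.free
  have := hπ.finite
  have hjac : maximalIdeal R ≤ Ideal.jacobson ⊥ := (jacobson_eq_maximalIdeal ⊥ bot_ne_top).ge
  let f : R × R →ₗ[R] F :=
    (LinearMap.toSpanSingleton R F e₁).coprod (LinearMap.toSpanSingleton R F e₂)
  have hf : ∀ a b, f (a, b) = a • e₁ + b • e₂ := fun a b => by simp [f]
  have hsurj : Function.Surjective f := by
    rw [← LinearMap.range_eq_top, eq_top_iff]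
    refine Submodule.le_of_le_smul_of_le_jacobson_bot Module.Finite.fg_top hjac ?_
    intro z _
    obtain ⟨a, b, hab⟩ := Ideal.mem_span_pair.1 (hgen.le (π z).2)
    refine Submodule.mem_sup.2 ⟨f (a, b), LinearMap.mem_range_self _ _, z - f (a, b), ?_, by abel⟩
    refine hπ.ker_le ?_
    rw [LinearMap.mem_ker, hf, map_sub, sub_eq_zero]
    apply Subtype.ext
    simp [hab]
  -- Independence: `R² → F` splits and its kernel lies in `𝔪R²`, so by Nakayama the section is onto
  -- and the kernel vanishes.
  obtain ⟨s, hs⟩ := Module.projective_lifting_property f LinearMap.id hsurj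
  have hs' : ∀ z, f (s z) = z := fun z => LinearMap.congr_fun hs z
  have hker : ∀ a b, f (a, b) = 0 → a ∈ maximalIdeal R ∧ b ∈ maximalIdeal R := by
    intro a b h
    refine coeff_mem_maximalIdeal_of_add_eq_zero hnp hgen ?_
    have := congrArg (fun z => (π z : R)) ((hf a b).symm.trans h)
    simpa using this
  have htop : LinearMap.range s = ⊤ := by
    rw [eq_top_iff]
    refine Submodule.le_of_le_smul_of_le_jacobson_bot Module.Finite.fg_top hjac ?_
    intro z _
    refine Submodule.mem_sup.2 ⟨s (f z), LinearMap.mem_range_self _ _, z - s (f z), ?_, by abel⟩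
    have h0 : f (z - s (f z)) = 0 := by rw [map_sub, hs', sub_self]
    obtain ⟨⟨a, b⟩, hab⟩ : ∃ w, z - s (f z) = w := ⟨_, rfl⟩
    rw [hab] at h0 ⊢
    obtain ⟨ha, hb⟩ := hker a b h0
    have : ((a, b) : R × R) = a • (1, 0) + b • (0, 1) := by simp
    rw [this]
    exact add_mem (Submodule.smul_mem_smul ha trivial) (Submodule.smul_mem_smul hb trivial)
  refine ⟨fun z => ?_, fun a b h => ?_⟩
  · obtain ⟨⟨a, b⟩, rfl⟩ := hsurj z
    exact ⟨a, b, hf a b⟩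
  · obtain ⟨z, hz⟩ := LinearMap.range_eq_top.1 htop (a, b)
    rw [← hf, ← hz, hs'] at h
    rw [h, map_zero] at hz
    exact ⟨(congrArg Prod.fst hz).symm, (congrArg Prod.snd hz).symm⟩

variable (π) in
/-- The Koszul syzygy on the images of `e₁` and `e₂`. -/
def koszulCycle (e₁ e₂ : F) : LinearMap.ker π :=
  ⟨(π e₂ : R) • e₁ - (π e₁ : R) • e₂, by
    rw [LinearMap.mem_ker, map_sub, map_smul, map_smul, sub_eq_zero]
    exact Subtype.ext (mul_comm _ _)⟩

theorem coeff_relation {ζ : LinearMap.ker π} {e₁ e₂ : F} {a b : R}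
    (h : (ζ : F) = a • e₁ + b • e₂) : a * (π e₁ : R) + b * (π e₂ : R) = 0 := by
  have := congrArg Subtype.val (ζ.2 : π ζ = 0)
  rw [h] at this
  simpa using this

theorem smul_cycle_left {ζ : LinearMap.ker π} {e₁ e₂ : F} {a b : R}
    (h : (ζ : F) = a • e₁ + b • e₂) : (π e₁ : R) • ζ = -b • koszulCycle π e₁ e₂ := by
  have hr := coeff_relation h
  apply Subtype.ext
  simp only [koszulCycle, Submodule.coe_smul, h, smul_add, smul_sub, smul_smul]
  have : (π e₁ : R) * a = -b * (π e₂ : R) := by linear_combination hr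
  rw [this, sub_eq_add_neg, ← neg_smul]
  congr 2
  ring

theorem smul_cycle_right {ζ : LinearMap.ker π} {e₁ e₂ : F} {a b : R}
    (h : (ζ : F) = a • e₁ + b • e₂) : (π e₂ : R) • ζ = a • koszulCycle π e₁ e₂ := by
  have hr := coeff_relation h
  apply Subtype.ext
  simp only [koszulCycle, Submodule.coe_smul, h, smul_add, smul_sub, smul_smul]
  have : (π e₂ : R) * b = -(a * (π e₁ : R)) := by linear_combination hr
  rw [this, sub_eq_add_neg, ← neg_smul]
  congr 2
  ring

theorem exists_smul_cycle_eq (hnp : ∀ z, maximalIdeal R ≠ Ideal.span {z}) {e₁ e₂ : F}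
    (he : IsBasisPair R e₁ e₂) (hgen : maximalIdeal R = Ideal.span {(π e₁ : R), (π e₂ : R)})
    {r : R} (hr : r ∈ maximalIdeal R) (ζ : LinearMap.ker π) :
    ∃ t ∈ maximalIdeal R, r • ζ = t • koszulCycle π e₁ e₂ := by
  obtain ⟨a, b, h⟩ := he.span ζ
  obtain ⟨ha, hb⟩ := coeff_mem_maximalIdeal_of_add_eq_zero hnp hgen (coeff_relation h)
  obtain ⟨c, d, rfl⟩ := Ideal.mem_span_pair.1 (hgen ▸ hr)
  refine ⟨c * -b + d * a, add_mem (Ideal.mul_mem_left _ _ (neg_mem hb))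
    (Ideal.mul_mem_left _ _ ha), ?_⟩
  rw [add_smul, mul_smul, mul_smul, smul_cycle_left h, smul_cycle_right h, smul_smul, smul_smul,
    ← add_smul]

/-- The hypotheses force `xκ = xQκ` and `yκ = yPκ`: each generator sees only one of the two
components of `κ`. -/
theorem span_inf_span_eq_bot_of_projections (hnp : ∀ z, maximalIdeal R ≠ Ideal.span {z})
    {e₁ e₂ : F} (he : IsBasisPair R e₁ e₂)
    (hgen : maximalIdeal R = Ideal.span {(π e₁ : R), (π e₂ : R)})
    {P Q : LinearMap.ker π →ₗ[R] LinearMap.ker π} (hPP : ∀ z, P (P z) = P z)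
    (hPQ : ∀ z, P (Q z) = 0)
    (hsum : ∀ r ∈ maximalIdeal R, ∀ z, r • z = r • P z + r • Q z)
    (hP : (π e₁ : R) • P (koszulCycle π e₁ e₂) = 0)
    (hQ : (π e₂ : R) • Q (koszulCycle π e₁ e₂) = 0) (z : R)
    (hz : z ∈ Ideal.span {(π e₁ : R)}) (hz' : z ∈ Ideal.span {(π e₂ : R)}) : z = 0 := by
  set κ := koszulCycle π e₁ e₂ with hκ
  set x : R := (π e₁ : R) with hx
  set y : R := (π e₂ : R) with hy
  have hκ' : (κ : F) = y • e₁ - x • e₂ := rfl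
  have hxκ : x • κ = x • Q κ := by rw [hsum x (π e₁).2 κ, hP, zero_add]
  have hyκ : y • κ = y • P κ := by rw [hsum y (π e₂).2 κ, hQ, add_zero]
  -- With `Qκ = b₁e₁ + b₂e₂`, comparing `e₁`-coefficients in `xκ = xQκ` gives `xy = xb₁ = -yb₂ = 0`.
  have hxy : x * y = 0 := by
    obtain ⟨b₁, b₂, hb⟩ := he.span (Q κ)
    have h1 := he.indep (y * b₁) (y * b₂) (by
      rw [mul_smul, mul_smul, ← smul_add, ← hb]
      exact congrArg Subtype.val hQ)
    have h2 := coeff_relation hb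
    have h3 := he.coeff_eq (a := x * y) (b := -(x * x)) (a' := x * b₁) (b' := x * b₂) (by
      have := congrArg Subtype.val hxκ
      simp only [Submodule.coe_smul, hκ', hb] at this
      rw [mul_smul, mul_smul x b₁, mul_smul x b₂, ← smul_add, ← this, neg_smul, mul_smul, smul_sub,
        sub_eq_add_neg])
    linear_combination h3.1 + h2 - h1.2
  obtain ⟨r, rfl⟩ := Ideal.mem_span_singleton'.1 hz
  obtain ⟨s, hs⟩ := Ideal.mem_span_singleton'.1 hz'
  obtain ⟨hrm, hsm⟩ := coeff_mem_maximalIdeal_of_add_eq_zero hnp hgen (a := r) (b := -s)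
    (by linear_combination -hs)
  rw [neg_mem_iff] at hsm
  obtain ⟨r₁, r₂, hr'⟩ := Ideal.mem_span_pair.1 (hgen ▸ hrm)
  obtain ⟨s₁, s₂, hs'⟩ := Ideal.mem_span_pair.1 (hgen ▸ hsm)
  have hrs : r₁ * x * x = s₂ * y * y := by
    linear_combination (s₁ - r₂) * hxy - hs + x * hr' - y * hs'
  -- As `xy = 0`, a common element `z = rx = sy` equals `r₁x² = s₂y²`, which is a new syzygy. Here
  -- `xζ` is fixed by `P` and `yζ` is killed by `P`; the relation on the coefficients of `Pζ` then
  -- gives `r₁x² = 0`.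
  let ζ : LinearMap.ker π := ⟨(r₁ * x) • e₁ + (-(s₂ * y)) • e₂, by
    rw [LinearMap.mem_ker]
    apply Subtype.ext
    simp only [map_add, map_smul, Submodule.coe_add, Submodule.coe_smul, smul_eq_mul,
      ZeroMemClass.coe_zero, ← hx, ← hy]
    linear_combination hrs⟩
  have h1 : x • ζ = s₂ • y • P κ := by
    rw [smul_cycle_left (ζ := ζ) rfl, neg_neg, mul_smul, hyκ]
  have h2 : y • ζ = r₁ • x • Q κ := by
    rw [smul_cycle_right (ζ := ζ) rfl, mul_smul, hxκ]
  have h3 : x • P ζ = x • ζ := by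
    rw [← map_smul, h1, map_smul, map_smul, hPP]
  have h4 : y • P ζ = 0 := by
    rw [← map_smul, h2, map_smul, map_smul, hPQ, smul_zero, smul_zero]
  obtain ⟨u, v, huv⟩ := he.span (P ζ)
  have h5 := coeff_relation huv
  have h6 := he.indep (y * u) (y * v) (by
      rw [mul_smul, mul_smul, ← smul_add, ← huv]
      exact congrArg Subtype.val h4)
  have h7 := he.coeff_eq (a := x * u) (b := x * v) (a' := x * (r₁ * x)) (b' := x * (-(s₂ * y))) (by
      have := congrArg Subtype.val h3
      simp only [Submodule.coe_smul, huv] at this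
      rw [mul_smul, mul_smul, ← smul_add, this, mul_smul, mul_smul x (-(s₂ * y)), ← smul_add])
  linear_combination -x * hr' + r₂ * hxy + h5 - h6.2 - h7.1

theorem koszulCycle_change (e₁ e₂ : F) (a b c d : R) :
    koszulCycle π (a • e₁ + b • e₂) (c • e₁ + d • e₂) =
      (a * d - b * c) • koszulCycle π e₁ e₂ := by
  apply Subtype.ext
  simp only [koszulCycle, map_add, map_smul, Submodule.coe_add, Submodule.coe_smul, smul_eq_mul]
  module

/-- `P + Q` need only be the identity after multiplication by `𝔪`, because in the application it
projects `Z` onto `N` along `N'`, and `𝔪N' = 0`. -/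
theorem smul_projection_eq_zero_or (hπ : IsMinimalFreeCover (maximalIdeal R) π)
    (hnp : ∀ z, maximalIdeal R ≠ Ideal.span {z})
    (hind : IsIndecomposableModule R (maximalIdeal R)) {e₁ e₂ : F}
    (hgen : maximalIdeal R = Ideal.span {(π e₁ : R), (π e₂ : R)})
    {P Q : LinearMap.ker π →ₗ[R] LinearMap.ker π} (hPP : ∀ z, P (P z) = P z)
    (hPQ : ∀ z, P (Q z) = 0) (hQP : ∀ z, Q (P z) = 0)
    (hsum : ∀ r ∈ maximalIdeal R, ∀ z, r • z = r • P z + r • Q z) :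
    (∀ r ∈ maximalIdeal R, ∀ z, r • P z = 0) ∨ ∀ r ∈ maximalIdeal R, ∀ z, r • Q z = 0 := by
  have he := hπ.isBasisPair hnp hgen
  set κ := koszulCycle π e₁ e₂ with hκ
  set p : Ideal R := maximalIdeal R ⊓ LinearMap.ker (LinearMap.toSpanSingleton R _ (P κ)) with hp
  set q : Ideal R := maximalIdeal R ⊓ LinearMap.ker (LinearMap.toSpanSingleton R _ (Q κ)) with hq
  -- If `rPκ = tκ`, applying `P` gives `(r - t)Pκ = 0` and applying `Q` gives `tQκ = 0`.
  have hpq : p ⊔ q = maximalIdeal R := by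
    refine le_antisymm (sup_le inf_le_left inf_le_left) fun r hr => ?_
    obtain ⟨t, ht, h⟩ := exists_smul_cycle_eq hnp he hgen hr (P κ)
    refine Submodule.mem_sup.2 ⟨r - t, ⟨sub_mem hr ht, ?_⟩, t, ⟨ht, ?_⟩, by abel⟩
    · have := congrArg P h
      rw [map_smul, map_smul, hPP] at this
      simp [sub_smul, this, κ]
    · have := congrArg Q h
      rw [map_smul, map_smul, hQP, smul_zero] at this
      simpa [κ] using this.symm
  have key : ∀ T : LinearMap.ker π →ₗ[R] LinearMap.ker π, (∀ r ∈ maximalIdeal R, r • T κ = 0) →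
      ∀ r ∈ maximalIdeal R, ∀ z, r • T z = 0 := by
    intro T hT r hr z
    obtain ⟨t, ht, h⟩ := exists_smul_cycle_eq hnp he hgen hr z
    rw [← map_smul, h, map_smul, hT t ht]
  rcases exists_span_pair_eq_of_sup_eq hgen hpq with h | h | ⟨x, hx, y, hy, hxy⟩
  · exact Or.inl (key P fun r hr => (h ▸ hr : r ∈ p).2)
  · exact Or.inr (key Q fun r hr => (h ▸ hr : r ∈ q).2)
  · exfalso
    obtain ⟨a, b, hab⟩ := Ideal.mem_span_pair.1 (hgen ▸ hx.1)
    obtain ⟨c, d, hcd⟩ := Ideal.mem_span_pair.1 (hgen ▸ hy.1)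
    have h1 : (π (a • e₁ + b • e₂) : R) = x := by simp [← hab]
    have h2 : (π (c • e₁ + d • e₂) : R) = y := by simp [← hcd]
    have hgen' : maximalIdeal R =
        Ideal.span {(π (a • e₁ + b • e₂) : R), (π (c • e₁ + d • e₂) : R)} := by rw [h1, h2, hxy]
    refine not_isIndecomposableModule_of_span_pair hnp hgen'
      (span_inf_span_eq_bot_of_projections hnp (hπ.isBasisPair hnp hgen') hgen' hPP hPQ hsum ?_ ?_)
      hind
    -- Changing generators multiplies `κ` by a determinant, so the vanishing persists.
    · rw [h1, koszulCycle_change, map_smul, smul_comm]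
      have : x • P κ = 0 := hx.2
      rw [this, smul_zero]
    · rw [h2, koszulCycle_change, map_smul, smul_comm]
      have : y • Q κ = 0 := hy.2
      rw [this, smul_zero]

end TwoGenerated

/-! ### Regular parameters in dimension two: primes and Koszul exactness -/

section DimensionTwo

variable {S : Type*} [CommRing S] [IsLocalRing S] [IsNoetherianRing S]

/-- Krull's principal ideal theorem: the maximal ideal has height 2. -/
theorem maximalIdeal_notMem_minimalPrimes_span_singleton (hdim : ringKrullDim S = 2) (z : S) :
    maximalIdeal S ∉ (Ideal.span {z}).minimalPrimes := by
  intro h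
  have h1 := Ideal.height_le_one_of_isPrincipal_of_mem_minimalPrimes _ _ h
  have h2 := maximalIdeal_height_eq_ringKrullDim (R := S)
  rw [hdim] at h2
  have h3 : (maximalIdeal S).height = 2 := WithBot.coe_injective h2
  rw [h3] at h1
  exact absurd h1 (by norm_num)

theorem maximalIdeal_ne_span_singleton (hdim : ringKrullDim S = 2) (z : S) :
    maximalIdeal S ≠ Ideal.span {z} := by
  intro h
  refine maximalIdeal_notMem_minimalPrimes_span_singleton hdim z ?_
  rw [← h, Ideal.minimalPrimes_eq_subsingleton_self]
  rfl

/-- Otherwise every prime containing `y` contains `x`, making `𝔫` minimal over `(y)`. -/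
theorem pow_notMem_span_singleton (hdim : ringKrullDim S = 2) {x y : S}
    (hgen : maximalIdeal S = Ideal.span {x, y}) (n : ℕ) : x ^ n ∉ Ideal.span {y} := by
  intro h
  have hy : y ∈ maximalIdeal S := hgen ▸ Ideal.subset_span (by simp)
  refine maximalIdeal_notMem_minimalPrimes_span_singleton hdim y
    ⟨⟨inferInstance, (Ideal.span_singleton_le_iff_mem _).2 hy⟩, ?_⟩
  rintro P ⟨hP, hyP⟩ -
  rw [hgen, Ideal.span_le]
  rintro z (rfl | rfl)
  · exact hP.mem_of_pow_mem n (hyP h)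
  · exact hyP (Ideal.mem_span_singleton_self _)

/-- `S/(y)` has principal maximal ideal `(x)`, and Krull's intersection theorem bounds the `x`-adic
order of a nonzero element. -/
theorem exists_unit_mul_pow_sub_mem {x y : S} (hgen : maximalIdeal S = Ideal.span {x, y}) {a : S}
    (ha : a ∉ Ideal.span {y}) : ∃ (u : S) (k : ℕ), IsUnit u ∧ a - u * x ^ k ∈ Ideal.span {y} := by
  classical
  have hx : x ∈ maximalIdeal S := hgen ▸ Ideal.subset_span (by simp)
  have hex : ∃ k, ∀ c, a - c * x ^ k ∉ Ideal.span {y} := by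
    by_contra! hcon
    have hbot := Ideal.iInf_pow_smul_eq_bot_of_isLocalRing (M := S ⧸ Ideal.span {y})
      (Ideal.span {x}) (fun h => (Ideal.IsPrime.ne_top' (I := maximalIdeal S))
        (top_le_iff.1 (h ▸ (Ideal.span_singleton_le_iff_mem _).2 hx)))
    have hmem : Ideal.Quotient.mk (Ideal.span {y}) a ∈
        (⨅ i : ℕ, Ideal.span {x} ^ i • (⊤ : Submodule S (S ⧸ Ideal.span {y}))) := by
      rw [Submodule.mem_iInf]
      intro k
      obtain ⟨c, hc⟩ := hcon k
      have : Ideal.Quotient.mk (Ideal.span {y}) a = x ^ k • Ideal.Quotient.mk (Ideal.span {y}) c := by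
        rw [Ideal.Quotient.eq.2 hc, mul_comm]
        rfl
      rw [this]
      exact Submodule.smul_mem_smul (Ideal.pow_mem_pow (Ideal.mem_span_singleton_self _) k) trivial
    rw [hbot, Submodule.mem_bot, Ideal.Quotient.eq_zero_iff_mem] at hmem
    exact ha hmem
  -- The least exponent that fails is positive, and its predecessor is the order of `a`; a nonunit
  -- cofactor would raise that order.
  obtain ⟨k, hk, hmin⟩ : ∃ k, (∀ c, a - c * x ^ k ∉ Ideal.span {y}) ∧
      ∀ j < k, ¬ ∀ c, a - c * x ^ j ∉ Ideal.span {y} :=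
    ⟨Nat.find hex, Nat.find_spec hex, fun j hj => Nat.find_min hex hj⟩
  cases k with
  | zero => exact absurd (by simp) (hk a)
  | succ k =>
    have := hmin k (Nat.lt_succ_self k)
    push Not at this
    obtain ⟨u, hu⟩ := this
    refine ⟨u, k, ?_, hu⟩
    by_contra hun
    obtain ⟨c, d, hcd⟩ := Ideal.mem_span_pair.1 (hgen ▸ ((mem_maximalIdeal u).2 hun))
    refine hk c ?_
    have : a - c * x ^ (k + 1) = (a - u * x ^ k) + d * x ^ k * y := by
      linear_combination -x ^ k * hcd
    rw [this]
    exact add_mem hu (Ideal.mul_mem_left _ _ (Ideal.mem_span_singleton_self _))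

/-- Modulo `y`, a product of units times powers of `x` is a unit times a power of `x`, hence
nonzero. -/
theorem isPrime_span_singleton (hdim : ringKrullDim S = 2) {x y : S}
    (hgen : maximalIdeal S = Ideal.span {x, y}) : (Ideal.span {y}).IsPrime := by
  constructor
  · intro h
    exact pow_notMem_span_singleton hdim hgen 0 (h ▸ trivial)
  · intro a b hab
    by_contra! hcon
    obtain ⟨u, k, hu, hk⟩ := exists_unit_mul_pow_sub_mem hgen hcon.1
    obtain ⟨v, l, hv, hl⟩ := exists_unit_mul_pow_sub_mem hgen hcon.2
    refine pow_notMem_span_singleton hdim hgen (k + l) ?_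
    obtain ⟨w, hw⟩ := (hu.mul hv).exists_left_inv
    have : x ^ (k + l) = w * (a * b - b * (a - u * x ^ k) - u * x ^ k * (b - v * x ^ l)) := by
      rw [pow_add]
      linear_combination -x ^ k * x ^ l * hw
    rw [this]
    exact Ideal.mul_mem_left _ _ (sub_mem (sub_mem hab (Ideal.mul_mem_left _ _ hk))
      (Ideal.mul_mem_left _ _ hl))

/-- That `S` is a domain is not presupposed. The elements `y + x^(i+1)` generate infinitely many
distinct primes, none containing `x`. From `ux = 0` each must divide what remains of `u`, so `u`
lies in every power of `𝔫` and vanishes. -/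
theorem eq_zero_of_mul_eq_zero_of_span_pair (hdim : ringKrullDim S = 2) {x y : S}
    (hgen : maximalIdeal S = Ideal.span {x, y}) {u : S} (hu : u * x = 0) : u = 0 := by
  have hx : x ∈ maximalIdeal S := hgen ▸ Ideal.subset_span (by simp)
  let z : ℕ → S := fun i => y + x ^ (i + 1)
  have hz : ∀ i, maximalIdeal S = Ideal.span {x, z i} := by
    intro i
    rw [hgen]
    apply le_antisymm <;> rw [Ideal.span_le]
    · rintro w (rfl | rfl)
      · exact Ideal.subset_span (by simp)
      · exact Ideal.mem_span_pair.2 ⟨-x ^ i, 1, by simp only [z]; ring⟩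
    · rintro w (rfl | rfl)
      · exact Ideal.subset_span (by simp)
      · exact Ideal.mem_span_pair.2 ⟨x ^ i, 1, by simp only [z]; ring⟩
  have hzm : ∀ i, z i ∈ maximalIdeal S := fun i => hz i ▸ Ideal.subset_span (by simp)
  -- `z i - z k` is a unit times `x^(i+1)`, and no power of `x` lies in `(z k)`.
  have hne : ∀ i k, i < k → z i ∉ Ideal.span {z k} := by
    intro i k hik h
    have h1 : x ^ (i + 1) * (1 - x ^ (k - i)) ∈ Ideal.span {z k} := by
      have : x ^ (i + 1) * (1 - x ^ (k - i)) = z i - z k := by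
        have e : x ^ (k + 1) = x ^ (i + 1) * x ^ (k - i) := by
          rw [← pow_add]
          congr 1
          omega
        simp only [z, e]
        ring
      rw [this]
      exact sub_mem h (Ideal.mem_span_singleton_self _)
    have h2 : IsUnit (1 - x ^ (k - i)) :=
      isUnit_one_sub_self_of_mem_nonunits _ (Ideal.pow_mem_of_mem _ hx _ (by omega))
    exact pow_notMem_span_singleton hdim (hz k) (i + 1)
      ((Ideal.mul_unit_mem_iff_mem _ h2).1 h1)
  have hdiv : ∀ k, ∃ w, u = w * ∏ i ∈ Finset.range k, z i := by
    intro k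
    induction k with
    | zero => exact ⟨u, by simp⟩
    | succ k ih =>
      obtain ⟨w, hw⟩ := ih
      have hP := isPrime_span_singleton hdim (hz k)
      have h0 : w * (∏ i ∈ Finset.range k, z i) * x ∈ Ideal.span {z k} := by
        rw [← hw, hu]
        exact zero_mem _
      rcases hP.mem_or_mem h0 with h | h
      · rcases hP.mem_or_mem h with h | h
        · obtain ⟨w', rfl⟩ := Ideal.mem_span_singleton'.1 h
          exact ⟨w', by rw [hw, Finset.prod_range_succ]; ring⟩
        · obtain ⟨i, hi, h⟩ := (hP.prod_mem_iff).1 h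
          exact absurd h (hne i k (Finset.mem_range.1 hi))
      · exact absurd (by simpa using h) (pow_notMem_span_singleton hdim (hz k) 1)
  have hbot := Ideal.iInf_pow_eq_bot_of_isLocalRing (maximalIdeal S) Ideal.IsPrime.ne_top'
  rw [← Ideal.mem_bot, ← hbot, Submodule.mem_iInf]
  intro k
  obtain ⟨w, hw⟩ := hdiv k
  rw [hw]
  refine Ideal.mul_mem_left _ _ ?_
  have := Ideal.prod_mem_prod (s := Finset.range k) (I := fun _ => maximalIdeal S) (x := z)
    fun i _ => hzm i
  simpa using this

/-- Exactness of the Koszul complex on a system of generators of the maximal ideal. -/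
theorem exists_eq_mul_of_add_eq_zero (hdim : ringKrullDim S = 2) {x y : S}
    (hgen : maximalIdeal S = Ideal.span {x, y}) {a b : S} (h : a * x + b * y = 0) :
    ∃ c, a = c * y ∧ b = -(c * x) := by
  have hgen' : maximalIdeal S = Ideal.span {y, x} := by rw [hgen, Set.pair_comm]
  have hP := isPrime_span_singleton hdim hgen'
  have hb : b * y ∈ Ideal.span {x} :=
    Ideal.mem_span_singleton'.2 ⟨-a, by linear_combination -h⟩
  rcases hP.mem_or_mem hb with h1 | h1
  · obtain ⟨c, rfl⟩ := Ideal.mem_span_singleton'.1 h1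
    have := eq_zero_of_mul_eq_zero_of_span_pair hdim hgen (u := a + c * y)
      (by linear_combination h)
    exact ⟨-c, by linear_combination this, by ring⟩
  · exact absurd (by simpa using h1) (pow_notMem_span_singleton hdim hgen' 1)

end DimensionTwo

theorem exists_maximalIdeal_eq_span_pair {S : Type*} [CommRing S] [IsRegularLocalRing S]
    (hdim : ringKrullDim S = 2) :
    ∃ x y : S, maximalIdeal S = Ideal.span {x, y} := by
  have h := IsRegularLocalRing.spanFinrank_maximalIdeal (R := S)
  rw [hdim] at h
  have h2 : (maximalIdeal S).spanFinrank = 2 := by exact_mod_cast h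
  obtain ⟨s, hs, hspan⟩ :=
    Submodule.FG.exists_span_set_encard_eq_spanFinrank (IsNoetherian.noetherian (maximalIdeal S))
  rw [h2] at hs
  obtain ⟨x, y, -, rfl⟩ := Set.encard_eq_two.1 (by exact_mod_cast hs)
  exact ⟨x, y, hspan.symm⟩

/-! ### Numbers of generators as lengths -/

section Length

/-- Compares two quotients through a common cover, which avoids constructing a well-defined map
between them. -/
theorem length_eq_of_surjective_of_ker_iff {S D P Q : Type*} [CommRing S] [AddCommGroup D]
    [Module S D] [AddCommGroup P] [Module S P] [AddCommGroup Q] [Module S Q] {g : D →ₗ[S] P}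
    {h : D →ₗ[S] Q} (hg : Function.Surjective g) (hh : Function.Surjective h)
    (hk : ∀ d, g d = 0 ↔ h d = 0) : Module.length S P = Module.length S Q := by
  have : LinearMap.ker g = LinearMap.ker h := Submodule.ext hk
  exact (((g.quotKerEquivOfSurjective hg).symm.trans (Submodule.quotEquivOfEq _ _ this)).trans
    (h.quotKerEquivOfSurjective hh)).length_eq

variable {R : Type*} [CommRing R] [IsLocalRing R] {M : Type*} [AddCommGroup M] [Module R M]

theorem spanFinrank_eq_length {N : Submodule R M} (hN : N.FG) :
    (N.spanFinrank : ℕ∞) = Module.length R (N ⧸ maximalIdeal R • (⊤ : Submodule R N)) := by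
  let := Ideal.Quotient.field (maximalIdeal R)
  have : Module.Finite R N := Module.Finite.iff_fg.2 hN
  have : Module.Finite (R ⧸ maximalIdeal R) (N ⧸ maximalIdeal R • (⊤ : Submodule R N)) :=
    Module.Finite.of_restrictScalars_finite R _ _
  rw [spanFinrank_eq_finrank_quotient N hN,
    Module.length_eq_of_surjective (R := R ⧸ maximalIdeal R) Ideal.Quotient.mk_surjective,
    Module.length_eq_finrank]

theorem spanFinrank_top_eq_length [Module.Finite R M] :
    ((⊤ : Submodule R M).spanFinrank : ℕ∞) =
      Module.length R (M ⧸ maximalIdeal R • (⊤ : Submodule R M)) := by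
  rw [spanFinrank_eq_length Module.Finite.fg_top]
  let e : (⊤ : Submodule R M) ≃ₗ[R] M := Submodule.topEquiv
  refine length_eq_of_surjective_of_ker_iff (g := Submodule.mkQ _)
    (h := (Submodule.mkQ _).comp e.toLinearMap) (Submodule.mkQ_surjective _)
    ((Submodule.mkQ_surjective _).comp e.surjective) fun d => ?_
  simp only [Submodule.mkQ_apply, LinearMap.comp_apply, Submodule.Quotient.mk_eq_zero]
  rw [Submodule.mem_smul_top_iff]
  rfl

theorem length_pi_residue (a : ℕ) : Module.length R (Fin a → R ⧸ maximalIdeal R) = a := by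
  let := Ideal.Quotient.field (maximalIdeal R)
  rw [Module.length_eq_of_surjective (R := R ⧸ maximalIdeal R) Ideal.Quotient.mk_surjective,
    Module.length_eq_finrank]
  simp

theorem IsResidueSplitting.smul_eq_zero {N N' : Submodule R M} {a : ℕ}
    (h : IsResidueSplitting (maximalIdeal R) N N' a) : ∀ r ∈ maximalIdeal R, ∀ c ∈ N', r • c = 0 := by
  intro r hr c hc
  obtain ⟨f⟩ := h.iso
  have h1 : r • (⟨c, hc⟩ : N') = 0 := by
    apply f.injective
    rw [map_smul, map_zero]
    funext i
    obtain ⟨t, ht⟩ := Ideal.Quotient.mk_surjective (f ⟨c, hc⟩ i)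
    rw [Pi.smul_apply, ← ht]
    exact Ideal.Quotient.eq_zero_iff_mem.2 (Ideal.mul_mem_right _ _ hr)
  exact congrArg Subtype.val h1

theorem IsResidueSplitting.length_eq {N N' : Submodule R M} {a : ℕ}
    (h : IsResidueSplitting (maximalIdeal R) N N' a) : Module.length R N' = a := by
  obtain ⟨f⟩ := h.iso
  rw [f.length_eq, length_pi_residue]

/-- Since `𝔪N' = 0`, `M/𝔪M ≅ N/𝔪N ⊕ N'`. -/
theorem IsResidueSplitting.spanFinrank_add [Module.Finite R M] {N N' : Submodule R M} {a : ℕ}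
    (h : IsResidueSplitting (maximalIdeal R) N N' a) :
    ((⊤ : Submodule R N).spanFinrank : ℕ∞) + a =
      Module.length R (M ⧸ maximalIdeal R • (⊤ : Submodule R M)) := by
  have hc := h.isCompl
  let pN := N.projectionOnto N' hc
  let pN' := N'.projectionOnto N hc.symm
  have : Module.Finite R N :=
    Module.Finite.of_surjective pN (Submodule.projectionOnto_surjective hc)
  rw [spanFinrank_top_eq_length, ← h.length_eq, ← Module.length_prod]
  refine length_eq_of_surjective_of_ker_iff (D := M)
    (g := ((maximalIdeal R • (⊤ : Submodule R N)).mkQ.comp pN).prod pN')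
    (h := Submodule.mkQ _) ?_ (Submodule.mkQ_surjective _) fun z => ?_
  · rintro ⟨n, c⟩
    obtain ⟨n, rfl⟩ := Submodule.mkQ_surjective _ n
    refine ⟨n + c, ?_⟩
    simp [pN, pN']
  · change ((maximalIdeal R • (⊤ : Submodule R N)).mkQ (pN z), pN' z) = 0 ↔ _
    rw [Prod.mk_eq_zero, Submodule.mkQ_apply, Submodule.mkQ_apply, Submodule.Quotient.mk_eq_zero,
      Submodule.Quotient.mk_eq_zero]
    constructor
    · rintro ⟨h1, h2⟩
      have h3 := map_mem_smul_top N.subtype _ h1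
      have h4 : z ∈ N := (Submodule.projectionOnto_apply_eq_zero_iff hc.symm).1 h2
      have h5 : pN z = ⟨z, h4⟩ := Submodule.projectionOnto_apply_left hc ⟨z, h4⟩
      rwa [h5] at h3
    · intro hz
      refine ⟨map_mem_smul_top pN _ hz, ?_⟩
      have h1 := map_mem_smul_top pN' _ hz
      have h2 : maximalIdeal R • (⊤ : Submodule R N') = ⊥ := by
        rw [eq_bot_iff, Submodule.smul_le]
        intro r hr c _
        exact Subtype.ext (h.smul_eq_zero r hr c c.2)
      rwa [h2, Submodule.mem_bot] at h1

/-- The class of `κ` spans a copy of `k` in `M/𝔪M`, with quotient `M/Rκ`. -/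
theorem length_quotient_smul_top_eq_add_one {κ : M}
    (hκ : κ ∉ maximalIdeal R • (⊤ : Submodule R M))
    (hle : maximalIdeal R • (⊤ : Submodule R M) ≤ Submodule.span R {κ}) :
    Module.length R (M ⧸ maximalIdeal R • (⊤ : Submodule R M)) =
      1 + Module.length R (M ⧸ Submodule.span R {κ}) := by
  set mM := maximalIdeal R • (⊤ : Submodule R M) with hmM
  have hs : ∀ r ∈ maximalIdeal R, r • mM.mkQ κ = 0 := fun r hr =>
    (Submodule.Quotient.mk_eq_zero _).2 (Submodule.smul_mem_smul hr trivial)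
  obtain ⟨f⟩ := nonempty_span_singleton_equiv_residue hs
    fun h => hκ ((Submodule.Quotient.mk_eq_zero _).1 h)
  have h1 : Module.length R (Submodule.span R {mM.mkQ κ}) = 1 := by
    rw [f.length_eq]
    have := (LinearEquiv.funUnique (Fin 1) R (R ⧸ maximalIdeal R)).length_eq
    rw [← this, length_pi_residue]
    rfl
  rw [← h1]
  refine Module.length_eq_add_of_exact (Submodule.subtype _) (Submodule.factor hle)
    Subtype.val_injective (Submodule.factor_surjective hle) ?_
  intro z
  obtain ⟨z, rfl⟩ := Submodule.mkQ_surjective _ z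
  have : Submodule.factor hle (mM.mkQ z) = (Submodule.span R {κ}).mkQ z := rfl
  rw [this, Submodule.mkQ_apply, Submodule.Quotient.mk_eq_zero]
  constructor
  · intro h
    obtain ⟨r, rfl⟩ := Submodule.mem_span_singleton.1 h
    exact ⟨⟨mM.mkQ (r • κ), by
      rw [map_smul]
      exact Submodule.smul_mem _ _ (Submodule.mem_span_singleton_self _)⟩, rfl⟩
  · rintro ⟨⟨w, hw⟩, h⟩
    obtain ⟨r, rfl⟩ := Submodule.mem_span_singleton.1 hw
    have h2 : mM.mkQ (z - r • κ) = 0 := by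
      rw [map_sub, ← h, map_smul]
      exact sub_self _
    rw [Submodule.mkQ_apply, Submodule.Quotient.mk_eq_zero] at h2
    have := add_mem (hle h2) (Submodule.smul_mem _ r (Submodule.mem_span_singleton_self κ))
    simpa using this

end Length

/-! ### The Koszul syzygy and indecomposability of `N` -/

section KoszulCycle

variable {R : Type*} [CommRing R] [IsLocalRing R] {F : Type*} [AddCommGroup F] [Module R F]
  {π : F →ₗ[R] maximalIdeal R} {e₁ e₂ : F}

theorem mem_smul_top_ker_iff (hnp : ∀ z, maximalIdeal R ≠ Ideal.span {z})
    (he : IsBasisPair R e₁ e₂) (hgen : maximalIdeal R = Ideal.span {(π e₁ : R), (π e₂ : R)})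
    (ζ : LinearMap.ker π) : ζ ∈ maximalIdeal R • (⊤ : Submodule R (LinearMap.ker π)) ↔
      ∃ t ∈ maximalIdeal R, ζ = t • koszulCycle π e₁ e₂ := by
  constructor
  · intro h
    induction h using Submodule.smul_induction_on' with
    | smul r hr z _ => exact exists_smul_cycle_eq hnp he hgen hr z
    | add z _ w _ hz hw =>
      obtain ⟨s, hs, rfl⟩ := hz
      obtain ⟨t, ht, rfl⟩ := hw
      exact ⟨s + t, add_mem hs ht, (add_smul _ _ _).symm⟩
  · rintro ⟨t, ht, rfl⟩
    exact Submodule.smul_mem_smul ht trivial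

/-- If `𝔪κ = 0` then `𝔪² = 0`; elements of `Rx ∩ Ry` have coefficients in `𝔪`, so they vanish and `𝔪
= Rx ⊕ Ry`. -/
theorem exists_smul_koszulCycle_ne_zero (hnp : ∀ z, maximalIdeal R ≠ Ideal.span {z})
    (hind : IsIndecomposableModule R (maximalIdeal R))
    (he : IsBasisPair R e₁ e₂) (hgen : maximalIdeal R = Ideal.span {(π e₁ : R), (π e₂ : R)}) :
    ∃ r ∈ maximalIdeal R, r • koszulCycle π e₁ e₂ ≠ 0 := by
  by_contra! h
  have hsq : ∀ r ∈ maximalIdeal R, ∀ i : R, i ∈ maximalIdeal R → r * i = 0 := by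
    intro r hr i hi
    have := he.indep (r * (π e₂ : R)) (-(r * (π e₁ : R))) (by
      have := congrArg Subtype.val (h r hr)
      rw [neg_smul, mul_smul, mul_smul, ← sub_eq_add_neg, ← smul_sub]
      exact this)
    obtain ⟨c, d, rfl⟩ := Ideal.mem_span_pair.1 (hgen ▸ hi)
    linear_combination d * this.1 - c * this.2
  refine not_isIndecomposableModule_of_span_pair hnp hgen (fun z hz hz' => ?_) hind
  obtain ⟨r, rfl⟩ := Ideal.mem_span_singleton'.1 hz
  obtain ⟨s, hs⟩ := Ideal.mem_span_singleton'.1 hz'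
  have := coeff_mem_maximalIdeal_of_add_eq_zero hnp hgen (a := r) (b := -s)
    (by linear_combination -hs)
  exact hsq r this.1 _ (π e₁).2

/-- Since `𝔪Z = 𝔪κ`, membership would give `κ = tκ` with `t ∈ 𝔪`, hence `κ = 0` and `y = 0`. -/
theorem koszulCycle_notMem_smul_top (hnp : ∀ z, maximalIdeal R ≠ Ideal.span {z})
    (he : IsBasisPair R e₁ e₂) (hgen : maximalIdeal R = Ideal.span {(π e₁ : R), (π e₂ : R)}) :
    koszulCycle π e₁ e₂ ∉ maximalIdeal R • (⊤ : Submodule R (LinearMap.ker π)) := by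
  intro h
  obtain ⟨t, ht, h⟩ := (mem_smul_top_ker_iff hnp he hgen _).1 h
  have hu : IsUnit (1 - t) := isUnit_one_sub_self_of_mem_nonunits _ ht
  have h0 : koszulCycle π e₁ e₂ = 0 := by
    rw [← hu.smul_eq_zero, sub_smul, one_smul, ← h, sub_self]
  have h1 := he.indep (π e₂ : R) (-(π e₁ : R)) (by
    rw [neg_smul, ← sub_eq_add_neg]
    exact congrArg Subtype.val h0)
  refine hnp (π e₁ : R) (hgen.trans ?_)
  rw [h1.1, Set.pair_comm]
  exact Ideal.span_insert_zero

theorem IsResidueSplitting.isIndecomposableModule (hπ : IsMinimalFreeCover (maximalIdeal R) π)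
    (hnp : ∀ z, maximalIdeal R ≠ Ideal.span {z})
    (hind : IsIndecomposableModule R (maximalIdeal R))
    (hgen : maximalIdeal R = Ideal.span {(π e₁ : R), (π e₂ : R)})
    {N N' : Submodule R (LinearMap.ker π)} {a : ℕ}
    (h : IsResidueSplitting (maximalIdeal R) N N' a) : IsIndecomposableModule R N := by
  have he := hπ.isBasisPair hnp hgen
  have hc := h.isCompl
  refine ⟨?_, fun A B hAB => ?_⟩
  -- If `N = 0`, then `Z = N'` is killed by `𝔪`, but `𝔪κ ≠ 0`.
  · rw [Submodule.nontrivial_iff_ne_bot]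
    intro hN
    rw [hN] at hc
    have htop := eq_top_of_bot_isCompl hc
    obtain ⟨r, hr, hne⟩ := exists_smul_koszulCycle_ne_zero hnp hind he hgen
    exact hne (h.smul_eq_zero r hr _ (htop ▸ trivial))
  · let pN := N.projectionOnto N' hc
    let pA := A.projection B hAB
    let pB := B.projection A hAB.symm
    have hpN : ∀ n : N, pN n = n := Submodule.projectionOnto_apply_left hc
    have hpAA : ∀ n, pA (pA n) = pA n := fun n =>
      Submodule.projection_apply_left hAB (A.projectionOnto B hAB n)
    have hpAB : ∀ n, pA (pB n) = 0 := fun n =>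
      Submodule.projection_apply_right hAB (B.projectionOnto A hAB.symm n)
    have hpBA : ∀ n, pB (pA n) = 0 := fun n =>
      Submodule.projection_apply_right hAB.symm (A.projectionOnto B hAB n)
    have hsum : ∀ n, pA n + pB n = n := fun n => Submodule.projection_add_projection_eq_self hAB n
    rcases smul_projection_eq_zero_or hπ hnp hind hgen
      (P := N.subtype ∘ₗ pA ∘ₗ pN) (Q := N.subtype ∘ₗ pB ∘ₗ pN)
      (fun z => by simp [hpN, hpAA]) (fun z => by simp [hpN, hpAB])
      (fun z => by simp [hpN, hpBA]) (fun r hr z => by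
        rw [← smul_add]
        have h1 : (N.subtype ∘ₗ pA ∘ₗ pN) z + (N.subtype ∘ₗ pB ∘ₗ pN) z = pN z := by
          simp only [LinearMap.comp_apply, Submodule.subtype_apply, ← Submodule.coe_add, hsum]
        have h2 : z - pN z ∈ N' := Submodule.sub_projection_mem hc z
        have h3 := h.smul_eq_zero r hr _ h2
        rw [h1]
        rwa [smul_sub, sub_eq_zero] at h3) with h1 | h1
    · left
      refine eq_bot_of_isCompl_of_smul_eq_zero h.no_summand hAB fun r hr n hn => ?_
      have h2 : pA n = n := Submodule.projection_apply_left hAB ⟨n, hn⟩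
      have h3 := h1 r hr n
      simp only [LinearMap.comp_apply, hpN, h2] at h3
      exact Subtype.ext h3
    · right
      refine eq_bot_of_isCompl_of_smul_eq_zero h.no_summand hAB.symm fun r hr n hn => ?_
      have h2 : pB n = n := Submodule.projection_apply_left hAB.symm ⟨n, hn⟩
      have h3 := h1 r hr n
      simp only [LinearMap.comp_apply, hpN, h2] at h3
      exact Subtype.ext h3

end KoszulCycle

/-! ### Lifting syzygies from `S/I` to `S` -/

section QuotientOfDimensionTwo

variable {S : Type*} [CommRing S] [IsLocalRing S] {I : Ideal S} {X Y : S}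

theorem mem_maximalIdeal_mul_iff (hgen : maximalIdeal S = Ideal.span {X, Y}) (J : Ideal S) (s : S) :
    s ∈ maximalIdeal S * J ↔ ∃ i ∈ J, ∃ j ∈ J, i * X + j * Y = s := by
  rw [hgen, Ideal.span_insert, Ideal.sup_mul, Submodule.mem_sup]
  simp only [Ideal.mem_span_singleton_mul]
  constructor
  · rintro ⟨_, ⟨i, hi, rfl⟩, _, ⟨j, hj, rfl⟩, rfl⟩
    exact ⟨i, hi, j, hj, by ring⟩
  · rintro ⟨i, hi, j, hj, rfl⟩
    exact ⟨_, ⟨i, hi, rfl⟩, _, ⟨j, hj, rfl⟩, by ring⟩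

/-- Otherwise `𝔫 = (z) + I ⊆ (z) + 𝔫²`, and Nakayama makes `𝔫` principal. -/
theorem maximalIdeal_quotient_ne_span_singleton [IsNoetherianRing S] [IsLocalRing (S ⧸ I)]
    (hdim : ringKrullDim S = 2) (hI : I ≤ maximalIdeal S ^ 2)
    (hm : maximalIdeal (S ⧸ I) = (maximalIdeal S).map (Ideal.Quotient.mk I)) (z : S ⧸ I) :
    maximalIdeal (S ⧸ I) ≠ Ideal.span {z} := by
  intro h
  obtain ⟨z, rfl⟩ := Ideal.Quotient.mk_surjective z
  have hI' : I ≤ maximalIdeal S := hI.trans (Ideal.pow_le_self two_ne_zero)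
  have hcomap : (maximalIdeal S) = Ideal.span {z} ⊔ I := by
    have h1 := congrArg (Ideal.comap (Ideal.Quotient.mk I)) (hm.symm.trans h)
    rw [← Set.image_singleton, ← Ideal.map_span,
      Ideal.comap_map_of_surjective _ Ideal.Quotient.mk_surjective,
      Ideal.comap_map_of_surjective _ Ideal.Quotient.mk_surjective, ← RingHom.ker_eq_comap_bot,
      Ideal.mk_ker, sup_eq_left.2 hI'] at h1
    exact h1
  refine maximalIdeal_ne_span_singleton hdim z (le_antisymm ?_ (hcomap ▸ le_sup_left))
  refine Submodule.le_of_le_smul_of_le_jacobson_bot (IsNoetherian.noetherian _)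
    (jacobson_eq_maximalIdeal ⊥ bot_ne_top).ge ?_
  calc maximalIdeal S ≤ Ideal.span {z} ⊔ I := hcomap.le
    _ ≤ _ := sup_le_sup_left (hI.trans (by rw [pow_two]; rfl)) _

variable {F : Type*} [AddCommGroup F] [Module (S ⧸ I) F] [Module S F] [IsScalarTower S (S ⧸ I) F]

omit [IsLocalRing S] in
theorem smul_eq_mk_smul (s : S) (f : F) : s • f = Ideal.Quotient.mk I s • f :=
  (algebraMap_smul (S ⧸ I) s f).symm

variable [IsLocalRing (S ⧸ I)] {π : F →ₗ[S ⧸ I] maximalIdeal (S ⧸ I)} {e₁ e₂ : F}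

omit [IsLocalRing S] in
theorem smul_add_smul_mem_ker_iff (h₁ : (π e₁ : S ⧸ I) = Ideal.Quotient.mk I X)
    (h₂ : (π e₂ : S ⧸ I) = Ideal.Quotient.mk I Y) (a b : S) :
    a • e₁ + b • e₂ ∈ LinearMap.ker π ↔ a * X + b * Y ∈ I := by
  rw [LinearMap.mem_ker, smul_eq_mk_smul (I := I), smul_eq_mk_smul (I := I), map_add, map_smul,
    map_smul, ← Ideal.Quotient.eq_zero_iff_mem, Subtype.ext_iff]
  simp [h₁, h₂]

/-- Being in `Rκ` means `(a, b) = c(Y, -X) + (i, j)` with `i, j ∈ I`, so `aX + bY = iX + jY`.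
Conversely, Koszul exactness in `S` applied to `(a - i, b - j)` recovers `c`. -/
theorem smul_add_smul_mem_span_koszulCycle_iff [IsNoetherianRing S] (hdim : ringKrullDim S = 2)
    (hgen : maximalIdeal S = Ideal.span {X, Y}) (he : IsBasisPair (S ⧸ I) e₁ e₂)
    (h₁ : (π e₁ : S ⧸ I) = Ideal.Quotient.mk I X)
    (h₂ : (π e₂ : S ⧸ I) = Ideal.Quotient.mk I Y) {a b : S} {ζ : LinearMap.ker π}
    (hζ : (ζ : F) = a • e₁ + b • e₂) :
    ζ ∈ Submodule.span (S ⧸ I) {koszulCycle π e₁ e₂} ↔ a * X + b * Y ∈ maximalIdeal S * I := by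
  have hcoe : ((koszulCycle π e₁ e₂ : LinearMap.ker π) : F) =
      Ideal.Quotient.mk I Y • e₁ - Ideal.Quotient.mk I X • e₂ := by
    rw [← h₁, ← h₂]
    rfl
  rw [smul_eq_mk_smul (I := I), smul_eq_mk_smul (I := I)] at hζ
  rw [mem_maximalIdeal_mul_iff hgen, Submodule.mem_span_singleton]
  constructor
  · rintro ⟨t, ht⟩
    obtain ⟨c, rfl⟩ := Ideal.Quotient.mk_surjective t
    have h3 := congrArg Subtype.val ht
    rw [Submodule.coe_smul, hcoe, hζ, smul_sub, smul_smul, smul_smul, sub_eq_add_neg,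
      ← neg_smul] at h3
    obtain ⟨h4, h5⟩ := he.coeff_eq h3
    rw [← map_mul, Ideal.Quotient.eq] at h4
    rw [← map_mul, ← map_neg, Ideal.Quotient.eq] at h5
    exact ⟨a - c * Y, by simpa using neg_mem h4, b - -(c * X), by simpa [add_comm] using neg_mem h5,
      by ring⟩
  · rintro ⟨i, hi, j, hj, hij⟩
    obtain ⟨c, h3, h4⟩ := exists_eq_mul_of_add_eq_zero hdim hgen (a := a - i) (b := b - j)
      (by linear_combination -hij)
    refine ⟨Ideal.Quotient.mk I c, Subtype.ext ?_⟩
    have h5 : Ideal.Quotient.mk I a = Ideal.Quotient.mk I c * Ideal.Quotient.mk I Y := by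
      rw [← map_mul, Ideal.Quotient.eq, ← h3]
      simpa using hi
    have h6 : Ideal.Quotient.mk I b = -(Ideal.Quotient.mk I c * Ideal.Quotient.mk I X) := by
      rw [← map_mul, ← map_neg, Ideal.Quotient.eq, ← h4]
      simpa using hj
    rw [Submodule.coe_smul, hcoe, hζ, h5, h6, smul_sub, smul_smul, smul_smul, sub_eq_add_neg,
      ← neg_smul]

/-- `Z / Rκ ≅ I / 𝔫 I` for `Z = ker π` and `κ` the Koszul syzygy. -/
theorem length_ker_quotient_span_koszulCycle [IsNoetherianRing S] (hdim : ringKrullDim S = 2)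
    (hI : I ≤ maximalIdeal S)
    (hgen : maximalIdeal S = Ideal.span {X, Y}) (he : IsBasisPair (S ⧸ I) e₁ e₂)
    (h₁ : (π e₁ : S ⧸ I) = Ideal.Quotient.mk I X)
    (h₂ : (π e₂ : S ⧸ I) = Ideal.Quotient.mk I Y) :
    Module.length (S ⧸ I) (LinearMap.ker π ⧸ Submodule.span (S ⧸ I) {koszulCycle π e₁ e₂}) =
      I.spanFinrank := by
  rw [← Module.length_eq_of_surjective (S := S) Ideal.Quotient.mk_surjective,
    spanFinrank_eq_length (IsNoetherian.noetherian I)]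
  let φ : S × S →ₗ[S] S := (LinearMap.toSpanSingleton S S X).coprod (LinearMap.toSpanSingleton S S Y)
  let ψ : S × S →ₗ[S] F := (LinearMap.toSpanSingleton S F e₁).coprod (LinearMap.toSpanSingleton S F e₂)
  have hφ : ∀ d, φ d = d.1 * X + d.2 * Y := fun d => by simp [φ]
  have hψ : ∀ d, ψ d = d.1 • e₁ + d.2 • e₂ := fun d => by simp [ψ]
  -- The lifts to `S²` of syzygies cover both `I/𝔫I` and `Z/Rκ`.
  let D : Submodule S (S × S) := Submodule.comap φ I
  let g : D →ₗ[S] I := φ.restrict fun d hd => hd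
  have hψD : ∀ d ∈ D, ψ d ∈ LinearMap.ker π := fun d hd => by
    have hd' : φ d ∈ I := hd
    rw [hφ] at hd'
    rw [hψ]
    exact (smul_add_smul_mem_ker_iff h₁ h₂ _ _).2 hd'
  let h : D →ₗ[S] LinearMap.ker π :=
    { toFun := fun d => ⟨ψ d, hψD d d.2⟩
      map_add' := fun c d => Subtype.ext (map_add ψ c.1 d.1)
      map_smul' := fun s d => Subtype.ext (map_smul ψ s d.1) }
  let K := Submodule.span (S ⧸ I) {koszulCycle π e₁ e₂}
  obtain ⟨q, hq, hq0⟩ : ∃ q : LinearMap.ker π →ₗ[S] LinearMap.ker π ⧸ K,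
      Function.Surjective q ∧ ∀ ζ, q ζ = 0 ↔ ζ ∈ K :=
    ⟨K.mkQ.restrictScalars S, K.mkQ_surjective, fun _ => Submodule.Quotient.mk_eq_zero K⟩
  symm
  refine length_eq_of_surjective_of_ker_iff (g := (Submodule.mkQ _).comp g) (h := q.comp h) ?_ ?_ ?_
  · refine (Submodule.mkQ_surjective _).comp ?_
    rintro ⟨i, hi⟩
    obtain ⟨a, b, hab⟩ := Ideal.mem_span_pair.1 (hgen ▸ hI hi)
    have hd : φ (a, b) = i := by rw [hφ, hab]
    exact ⟨⟨(a, b), by rw [Submodule.mem_comap, hd]; exact hi⟩, Subtype.ext hd⟩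
  · refine hq.comp ?_
    intro ζ
    obtain ⟨a, b, hab⟩ := he.span (ζ : F)
    obtain ⟨a, rfl⟩ := Ideal.Quotient.mk_surjective a
    obtain ⟨b, rfl⟩ := Ideal.Quotient.mk_surjective b
    rw [← smul_eq_mk_smul, ← smul_eq_mk_smul] at hab
    have hmem : a • e₁ + b • e₂ ∈ LinearMap.ker π := hab ▸ ζ.2
    refine ⟨⟨(a, b), ?_⟩, Subtype.ext ((hψ (a, b)).trans hab.symm)⟩
    rw [Submodule.mem_comap, hφ]
    exact (smul_add_smul_mem_ker_iff h₁ h₂ _ _).1 hmem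
  · intro d
    rw [LinearMap.comp_apply, Submodule.mkQ_apply, Submodule.Quotient.mk_eq_zero,
      Submodule.mem_smul_top_iff]
    rw [LinearMap.comp_apply, hq0]
    refine Iff.trans ?_
      (smul_add_smul_mem_span_koszulCycle_iff hdim hgen he h₁ h₂ (hψ d.1)).symm
    rw [← hφ]
    rfl

/-- `N' ≅ 𝔫 (I : 𝔫) / 𝔫 I`. -/
theorem IsResidueSplitting.length_colonQuotient [IsNoetherianRing S] (hdim : ringKrullDim S = 2)
    (hnp : ∀ z, maximalIdeal (S ⧸ I) ≠ Ideal.span {z})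
    (hind : IsIndecomposableModule (S ⧸ I) (maximalIdeal (S ⧸ I)))
    (hm : maximalIdeal (S ⧸ I) = (maximalIdeal S).map (Ideal.Quotient.mk I))
    (hgen : maximalIdeal S = Ideal.span {X, Y}) (he : IsBasisPair (S ⧸ I) e₁ e₂)
    (h₁ : (π e₁ : S ⧸ I) = Ideal.Quotient.mk I X)
    (h₂ : (π e₂ : S ⧸ I) = Ideal.Quotient.mk I Y)
    {N N' : Submodule (S ⧸ I) (LinearMap.ker π)} {a : ℕ}
    (hs : IsResidueSplitting (maximalIdeal (S ⧸ I)) N N' a) :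
    Module.length S (ColonQuotient I) = a := by
  have hgen' : maximalIdeal (S ⧸ I) = Ideal.span {(π e₁ : S ⧸ I), (π e₂ : S ⧸ I)} :=
    hm.trans (by rw [hgen, Ideal.map_span, Set.image_pair, h₁, h₂])
  have hc := hs.isCompl
  rw [← hs.length_eq, ← Module.length_eq_of_surjective (S := S) Ideal.Quotient.mk_surjective]
  let φ : S × S →ₗ[S] S := (LinearMap.toSpanSingleton S S X).coprod (LinearMap.toSpanSingleton S S Y)
  let ψ : S × S →ₗ[S] F := (LinearMap.toSpanSingleton S F e₁).coprod (LinearMap.toSpanSingleton S F e₂)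
  have hφ : ∀ d, φ d = d.1 * X + d.2 * Y := fun d => by simp [φ]
  have hψ : ∀ d, ψ d = d.1 • e₁ + d.2 • e₂ := fun d => by simp [ψ]
  let T : Ideal S := Submodule.colon I (maximalIdeal S : Set S)
  -- These are the lifts of socle elements of `Z`; they cover both `𝔫(I : 𝔫)/𝔫I` and `N'`.
  let D : Submodule S (S × S) := Submodule.prod T T
  have hφD : ∀ d ∈ D, φ d ∈ maximalMulColon I := fun d hd => by
    rw [hφ]
    exact (mem_maximalIdeal_mul_iff hgen T _).2 ⟨d.1, hd.1, d.2, hd.2, rfl⟩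
  let g : D →ₗ[S] maximalMulColon I := φ.restrict hφD
  have hψD : ∀ d ∈ D, ψ d ∈ LinearMap.ker π := fun d hd => by
    have hd' := maximalMulColon_le I (hφD d hd)
    rw [hφ] at hd'
    rw [hψ]
    exact (smul_add_smul_mem_ker_iff h₁ h₂ _ _).2 hd'
  let h : D →ₗ[S] LinearMap.ker π :=
    { toFun := fun d => ⟨ψ d, hψD d d.2⟩
      map_add' := fun c d => Subtype.ext (map_add ψ c.1 d.1)
      map_smul' := fun s d => Subtype.ext (map_smul ψ s d.1) }
  let p : LinearMap.ker π →ₗ[S] N' :=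
    (N'.projectionOnto N hc.symm).restrictScalars S
  have hp : ∀ ζ, p ζ = N'.projectionOnto N hc.symm ζ := fun _ => rfl
  refine length_eq_of_surjective_of_ker_iff (g := (Submodule.mkQ _).comp g) (h := p.comp h) ?_ ?_ ?_
  · refine (Submodule.mkQ_surjective _).comp ?_
    rintro ⟨s, hs'⟩
    obtain ⟨i, hi, j, hj, rfl⟩ := (mem_maximalIdeal_mul_iff hgen T s).1 hs'
    exact ⟨⟨(i, j), hi, hj⟩, Subtype.ext (hφ (i, j))⟩
  · intro c
    obtain ⟨a, b, hab⟩ := he.span ((c : LinearMap.ker π) : F)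
    obtain ⟨a, rfl⟩ := Ideal.Quotient.mk_surjective a
    obtain ⟨b, rfl⟩ := Ideal.Quotient.mk_surjective b
    have hT : a ∈ T ∧ b ∈ T := by
      have key : ∀ s ∈ maximalIdeal S, a * s ∈ I ∧ b * s ∈ I := by
        intro s hs'
        have h3 := hs.smul_eq_zero (Ideal.Quotient.mk I s)
          (hm ▸ Ideal.mem_map_of_mem _ hs') c c.2
        have h4 := congrArg Subtype.val h3
        rw [Submodule.coe_smul, hab, smul_add, smul_smul, smul_smul] at h4
        have h5 := he.indep _ _ h4
        rw [← map_mul, ← map_mul, Ideal.Quotient.eq_zero_iff_mem, Ideal.Quotient.eq_zero_iff_mem,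
          mul_comm s, mul_comm s] at h5
        exact h5
      exact ⟨Submodule.mem_colon.2 fun s hs' => (key s hs').1,
        Submodule.mem_colon.2 fun s hs' => (key s hs').2⟩
    refine ⟨⟨(a, b), hT⟩, ?_⟩
    have h3 : (h ⟨(a, b), hT⟩ : LinearMap.ker π) = c := by
      refine Subtype.ext ((hψ (a, b)).trans ?_)
      rw [hab, smul_eq_mk_smul (I := I), smul_eq_mk_smul (I := I)]
    rw [LinearMap.comp_apply, hp, h3]
    exact Submodule.projectionOnto_apply_left hc.symm c
  · intro d
    have h3 : ∀ r ∈ maximalIdeal (S ⧸ I), r • h d = 0 := by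
      intro r hr
      obtain ⟨s, rfl⟩ := Ideal.Quotient.mk_surjective r
      have hsS : s ∈ maximalIdeal S := by
        by_contra hn
        rw [mem_maximalIdeal, mem_nonunits_iff, not_not] at hn
        exact ((mem_maximalIdeal _).1 hr) (hn.map _)
      refine Subtype.ext ?_
      have h4 : (h d : F) = d.1.1 • e₁ + d.1.2 • e₂ := hψ d.1
      have h5 : s * d.1.1 ∈ I := mul_comm s d.1.1 ▸ Submodule.mem_colon.1 d.2.1 s hsS
      have h6 : s * d.1.2 ∈ I := mul_comm s d.1.2 ▸ Submodule.mem_colon.1 d.2.2 s hsS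
      rw [Submodule.coe_smul, h4, smul_eq_mk_smul (I := I), smul_eq_mk_smul (I := I), smul_add,
        smul_smul, smul_smul, ← map_mul, ← map_mul, Ideal.Quotient.eq_zero_iff_mem.2 h5,
        Ideal.Quotient.eq_zero_iff_mem.2 h6, zero_smul, zero_smul, add_zero]
      rfl
    rw [LinearMap.comp_apply, Submodule.mkQ_apply, Submodule.Quotient.mk_eq_zero,
      LinearMap.comp_apply, hp, Submodule.projectionOnto_apply_eq_zero_iff]
    have h4 : g d ∈ (maximalIdeal S * I).submoduleOf (maximalMulColon I) ↔
        d.1.1 * X + d.1.2 * Y ∈ maximalIdeal S * I := by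
      rw [← hφ]
      rfl
    rw [h4, ← smul_add_smul_mem_span_koszulCycle_iff hdim hgen he h₁ h₂ (ζ := h d) (hψ d.1)]
    constructor
    -- A socle element `tκ` has `t ∈ 𝔪`, since `κ` itself is not in the socle; its `N'`-component
    -- then lies in `𝔪N' = 0`.
    · intro h5
      obtain ⟨t, ht⟩ := Submodule.mem_span_singleton.1 h5
      have htm : t ∈ maximalIdeal (S ⧸ I) := by
        by_contra hn
        rw [mem_maximalIdeal, mem_nonunits_iff, not_not] at hn
        obtain ⟨r, hr, hne⟩ := exists_smul_koszulCycle_ne_zero hnp hind he hgen'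
        refine hne (hn.smul_eq_zero.1 ?_)
        rw [smul_comm, ht]
        exact h3 r hr
      rw [← Submodule.projectionOnto_apply_eq_zero_iff hc.symm, ← ht, map_smul]
      exact Subtype.ext (hs.smul_eq_zero t htm _ (Subtype.mem _))
    -- Conversely, `soc N ⊆ 𝔪N ⊆ 𝔪Z = 𝔪κ`, as `N` has no summand `k`.
    · intro h5
      have h6 : (⟨h d, h5⟩ : N) ∈ maximalIdeal (S ⧸ I) • (⊤ : Submodule (S ⧸ I) N) :=
        socle_mem_smul_top hs.no_summand fun r hr => Subtype.ext (h3 r hr)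
      have h7 := map_mem_smul_top N.subtype _ h6
      obtain ⟨t, -, ht⟩ := (mem_smul_top_ker_iff hnp he hgen' _).1 h7
      exact Submodule.mem_span_singleton.2 ⟨t, ht.symm⟩

end QuotientOfDimensionTwo

/-! ### Assembling the theorem -/

theorem length_colonQuotient_eq_toENat_rank {S : Type*} [CommRing S] [IsLocalRing S] (I : Ideal S) :
    Module.length S (ColonQuotient I) =
      (Module.rank (ResidueField S) (ColonQuotient I)).toENat := by
  have : IsScalarTower S (ResidueField S) (ColonQuotient I) :=
    (colonQuotient_isTorsion I).isScalarTower
  rw [Module.length_eq_of_surjective (R := ResidueField S) residue_surjective,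
    Module.length_eq_rank]

theorem theorem4p3 {S : Type*} [CommRing S] [IsRegularLocalRing S] (hdim : ringKrullDim S = 2)
    (I : Ideal S) (hI : I ≤ maximalIdeal S ^ 2)
    (m : Ideal (S ⧸ I)) (hm : m = (maximalIdeal S).map (Ideal.Quotient.mk I))
    (hind : IsIndecomposableModule (S ⧸ I) m)
    {F : Type*} [AddCommGroup F] [Module (S ⧸ I) F] (π : F →ₗ[S ⧸ I] m)
    (hπ : IsMinimalFreeCover m π) :
    (∃ (a : ℕ) (N N' : Submodule (S ⧸ I) (LinearMap.ker π)), IsResidueSplitting m N N' a) ∧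
    ∀ (a : ℕ) (N N' : Submodule (S ⧸ I) (LinearMap.ker π)), IsResidueSplitting m N N' a →
      (a : Cardinal) = Module.rank (ResidueField S) (ColonQuotient I) ∧
      ((⊤ : Submodule (S ⧸ I) N).spanFinrank : ℤ) = (I.spanFinrank : ℤ) + 1 - (a : ℤ) ∧
      1 ≤ (⊤ : Submodule (S ⧸ I) N).spanFinrank ∧
      IsIndecomposableModule (S ⧸ I) N := by
  have hIle : I ≤ maximalIdeal S := hI.trans (Ideal.pow_le_self two_ne_zero)
  have : Nontrivial (S ⧸ I) := Ideal.Quotient.nontrivial_iff.2 fun h =>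
    Ideal.IsPrime.ne_top' (I := maximalIdeal S) (top_le_iff.1 (h ▸ hIle))
  have : IsLocalRing (S ⧸ I) :=
    IsLocalRing.of_surjective' (Ideal.Quotient.mk I) Ideal.Quotient.mk_surjective
  have hmax : m = maximalIdeal (S ⧸ I) := by
    have hne : m ≠ ⊤ := by
      rw [hm]
      intro h
      have h1 := congrArg (Ideal.comap (Ideal.Quotient.mk I)) h
      rw [Ideal.comap_map_of_surjective _ Ideal.Quotient.mk_surjective,
        ← RingHom.ker_eq_comap_bot, Ideal.mk_ker, sup_eq_left.2 hIle, Ideal.comap_top] at h1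
      exact Ideal.IsPrime.ne_top' h1
    rcases Ideal.map_eq_top_or_isMaximal_of_surjective (Ideal.Quotient.mk I)
      Ideal.Quotient.mk_surjective (maximalIdeal.isMaximal S) with h | h
    · exact absurd (hm.trans h) hne
    · rw [hm]
      exact eq_maximalIdeal h
  subst hmax
  have := hπ.finite
  have hnp := maximalIdeal_quotient_ne_span_singleton hdim hI hm
  obtain ⟨X, Y, hgen⟩ := exists_maximalIdeal_eq_span_pair hdim
  have hX : X ∈ maximalIdeal S := hgen ▸ Ideal.subset_span (by simp)
  have hY : Y ∈ maximalIdeal S := hgen ▸ Ideal.subset_span (by simp)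
  obtain ⟨e₁, h₁⟩ := hπ.surjective ⟨Ideal.Quotient.mk I X, hm ▸ Ideal.mem_map_of_mem _ hX⟩
  obtain ⟨e₂, h₂⟩ := hπ.surjective ⟨Ideal.Quotient.mk I Y, hm ▸ Ideal.mem_map_of_mem _ hY⟩
  have h₁ := congrArg Subtype.val h₁
  have h₂ := congrArg Subtype.val h₂
  have hgen' : maximalIdeal (S ⧸ I) = Ideal.span {(π e₁ : S ⧸ I), (π e₂ : S ⧸ I)} :=
    hm.trans (by rw [hgen, Ideal.map_span, Set.image_pair, h₁, h₂])
  have he := hπ.isBasisPair hnp hgen'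
  let : Module S F := Module.compHom F (Ideal.Quotient.mk I)
  have : IsScalarTower S (S ⧸ I) F := ⟨fun s r f => by
    rw [Algebra.smul_def, mul_smul]
    rfl⟩
  refine ⟨exists_isResidueSplitting, fun a N N' hs => ?_⟩
  have hN := hs.isIndecomposableModule hπ hnp hind hgen'
  -- Both sides are `μ(Z)`: from `Z = N ⊕ N'` on the left, from `κ` and `Z/Rκ ≅ I/𝔫I` on the right.
  have hμ : (⊤ : Submodule (S ⧸ I) N).spanFinrank + a = 1 + I.spanFinrank := by
    have h3 := hs.spanFinrank_add
    rw [length_quotient_smul_top_eq_add_one (koszulCycle_notMem_smul_top hnp he hgen') fun z hz => by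
        obtain ⟨t, -, rfl⟩ := (mem_smul_top_ker_iff hnp he hgen' z).1 hz
        exact Submodule.smul_mem _ _ (Submodule.mem_span_singleton_self _),
      length_ker_quotient_span_koszulCycle hdim hIle hgen he h₁ h₂] at h3
    exact_mod_cast h3
  refine ⟨?_, by omega, ?_, hN⟩
  · have h3 := hs.length_colonQuotient hdim hnp hind hm hgen he h₁ h₂
    rw [length_colonQuotient_eq_toENat_rank, Cardinal.toENat_eq_natCast] at h3
    exact h3.symm
  · have := hN.1
    rw [Nat.one_le_iff_ne_zero, Ne,
      Submodule.spanFinrank_eq_zero_iff_eq_bot (IsNoetherian.noetherian _)]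
    exact top_ne_bot
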